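/- Let $\mathcal H$ be a complex Hilbert space with an orthonormal basis $(|n\rangle)_{n\ge 0}$, and let $\ell$ denote Lebesgue measure. For a Borel set $X\subseteq[0,2\pi)$ let $$E_{\rm can}(X)=\sum_{n,m=0}^\infty \frac1{2\pi}\int_X e^{i(n-m)x}\,dx\;|n\rangle\langle m|$$ (the canonical phase) and $$E_{|0\rangle}(X)=\sum_{n,m=0}^\infty \frac{\Gamma\left(\frac{n+m}2+1\right)}{\sqrt{n!}\,\sqrt{m!}}\,\frac1{2\pi}\int_X e^{i(n-m)x}\,dx\;|n\rangle\langle m|$$ (the phase space phase observable generated by the ground state $|0\rangle$), where each series denotes the unique bounded operator on $\mathcal H$ whose matrix elements $\langle n|E(X)|m\rangle$ are the displayed coefficients. If $\ell(X)>0$, then the operator norms satisfy $$\|E_{\rm can}(X)\|=1\qquad\text{and}\qquad \|E_{|0\rangle}(X)\|=1.$$ -/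

import Mathlib

open MeasureTheory Set

namespace NumberPhase

/-- The bounded operator `A` is the sum of the (generally only weakly convergent) double series
`∑ n m, c n m * (1 / (2π) * ∫ x in X, e^{i(n-m)x}) |n⟩⟨m|`: its matrix elements `⟨n|A|m⟩` with
respect to the orthonormal basis `|n⟩ = b n` are the coefficients of the series. -/
def IsPhaseEffect {H : Type*} [NormedAddCommGroup H] [InnerProductSpace ℂ H]
    (b : HilbertBasis ℕ ℂ H) (c : ℕ → ℕ → ℂ) (X : Set ℝ) (A : H →L[ℂ] H) : Prop :=
  ∀ n m : ℕ, inner ℂ (b n) (A (b m)) =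
    c n m * (1 / (2 * (Real.pi : ℂ)) *
      ∫ x in X, Complex.exp (Complex.I * ((n : ℂ) - (m : ℂ)) * (x : ℂ)))

/-- A bounded operator is determined by its matrix elements. -/
theorem IsPhaseEffect.unique {H : Type*} [NormedAddCommGroup H] [InnerProductSpace ℂ H]
    {b : HilbertBasis ℕ ℂ H} {c : ℕ → ℕ → ℂ} {X : Set ℝ} {A B : H →L[ℂ] H}
    (hA : IsPhaseEffect b c X A) (hB : IsPhaseEffect b c X B) : A = B := by
  have key : ∀ m, A (b m) = B (b m) := by
    intro m
    apply b.repr.injective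
    ext n
    rw [b.repr_apply_apply, b.repr_apply_apply, hA n m, hB n m]
  refine ContinuousLinearMap.ext_on (s := Set.range b) ?_ ?_
  · exact (Submodule.dense_iff_topologicalClosure_eq_top).2 b.dense_span
  · rintro _ ⟨m, rfl⟩
    exact key m

open Classical in
/-- The effect `E(X) = ∑ n m, c n m * (1 / (2π) * ∫ x in X, e^{i(n-m)x}) |n⟩⟨m|` with phase
matrix `c`: the unique bounded operator with these matrix elements (by convention `0` if there is
none, which does not happen for the two phase observables below: see `canonicalPhase_spec` and
`groundStatePhase_spec`). -/
noncomputable def phaseEffect {H : Type*} [NormedAddCommGroup H] [InnerProductSpace ℂ H]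
    (b : HilbertBasis ℕ ℂ H) (c : ℕ → ℕ → ℂ) (X : Set ℝ) : H →L[ℂ] H :=
  if h : ∃ A : H →L[ℂ] H, IsPhaseEffect b c X A then h.choose else 0

/-- The canonical phase: all entries of the phase matrix are `1`. -/
noncomputable def canonicalPhase {H : Type*} [NormedAddCommGroup H] [InnerProductSpace ℂ H]
    (b : HilbertBasis ℕ ℂ H) (X : Set ℝ) : H →L[ℂ] H :=
  phaseEffect b (fun _ _ => 1) X

/-- The phase matrix `Γ((n+m)/2 + 1) / (√n! √m!)` of the ground state phase. -/
noncomputable def groundStateMatrix (n m : ℕ) : ℂ :=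
  ((Real.Gamma (((n : ℝ) + (m : ℝ)) / 2 + 1) /
    (Real.sqrt (n.factorial : ℝ) * Real.sqrt (m.factorial : ℝ)) : ℝ) : ℂ)

/-- The phase space phase observable generated by the ground state `|0⟩`. -/
noncomputable def groundStatePhase {H : Type*} [NormedAddCommGroup H] [InnerProductSpace ℂ H]
    (b : HilbertBasis ℕ ℂ H) (X : Set ℝ) : H →L[ℂ] H :=
  phaseEffect b groundStateMatrix X

/-- Well-definedness: `phaseEffect` has the prescribed matrix elements as soon as some bounded
operator has them. -/
theorem isPhaseEffect_phaseEffect {H : Type*} [NormedAddCommGroup H] [InnerProductSpace ℂ H]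
    {b : HilbertBasis ℕ ℂ H} {c : ℕ → ℕ → ℂ} {X : Set ℝ}
    (h : ∃ A : H →L[ℂ] H, IsPhaseEffect b c X A) :
    IsPhaseEffect b c X (phaseEffect b c X) := by
  unfold phaseEffect
  rw [dif_pos h]
  exact h.choose_spec


/-- Compression of the multiplication by the indicator of `S` on an `L²` space. -/
theorem exists_of_orthonormal {H : Type*} [NormedAddCommGroup H] [InnerProductSpace ℂ H]
    [CompleteSpace H] (b : HilbertBasis ℕ ℂ H) {Ω : Type*} [MeasurableSpace Ω] (μ : Measure Ω)
    (f : ℕ → Ω → ℂ) (hf : ∀ n, MemLp (f n) 2 μ)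
    (ho : ∀ n m, ∫ x, f m x * (starRingEnd ℂ) (f n x) ∂μ = if n = m then 1 else 0) (S : Set Ω) :
    ∃ A : H →L[ℂ] H, ∀ n m, inner ℂ (b n) (A (b m)) =
      ∫ x in S, f m x * (starRingEnd ℂ) (f n x) ∂μ := by
  classical
  let e : ℕ → Lp ℂ 2 μ := fun n => (hf n).toLp (f n)
  have he : Orthonormal ℂ e := by
    rw [orthonormal_iff_ite]
    intro n m
    rw [← ho n m, L2.inner_def]
    refine integral_congr_ae ?_
    filter_upwards [(hf n).coeFn_toLp, (hf m).coeFn_toLp] with x h1 h2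
    simp [e, h1, h2]
  let V : H →L[ℂ] Lp ℂ 2 μ := he.orthogonalFamily.linearIsometry.toContinuousLinearMap.comp
    (b.repr.toLinearIsometry.toContinuousLinearMap)
  have hV : ∀ n, V (b n) = e n := by
    intro n
    simp [V, b.repr_self]
  let R : H →L[ℂ] Lp ℂ 2 (μ.restrict S) := (LpToLpRestrictCLM Ω ℂ ℂ μ 2 S).comp V
  refine ⟨(ContinuousLinearMap.adjoint R).comp R, fun n m => ?_⟩
  rw [ContinuousLinearMap.comp_apply, ContinuousLinearMap.adjoint_inner_right, L2.inner_def]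
  refine integral_congr_ae ?_
  have hR : ∀ n, R (b n) =ᵐ[μ.restrict S] f n := by
    intro n
    have h1 : R (b n) = LpToLpRestrictCLM Ω ℂ ℂ μ 2 S (e n) := by simp [R, hV]
    rw [h1]
    exact (LpToLpRestrictCLM_coeFn ℂ S (e n)).trans (ae_restrict_of_ae (hf n).coeFn_toLp)
  filter_upwards [hR n, hR m] with x h1 h2
  simp [h1, h2]

/-- The effects with a phase matrix of the form `∫ g n * g m` are bounded operators. -/
theorem exists_isPhaseEffect_of_gram {H : Type*} [NormedAddCommGroup H] [InnerProductSpace ℂ H]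
    [CompleteSpace H] (b : HilbertBasis ℕ ℂ H) (ν : Measure ℝ) [SFinite ν] (g : ℕ → ℝ → ℝ)
    (hg : ∀ n, MemLp (g n) 2 ν) (hg1 : ∀ n, ∫ r, g n r * g n r ∂ν = 1)
    {X : Set ℝ} (hX : X ⊆ Ico 0 (2 * Real.pi)) :
    ∃ A : H →L[ℂ] H, IsPhaseEffect b (fun n m => ((∫ r, g n r * g m r ∂ν : ℝ) : ℂ)) X A := by
  let μ : Measure ℝ := (ENNReal.ofReal (1 / (2 * Real.pi))) • volume.restrict (Ico 0 (2 * Real.pi))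
  let u : ℕ → ℝ → ℂ := fun n x => Complex.exp (-(Complex.I * (n : ℂ) * (x : ℂ)))
  have hu1 : ∀ n x, ‖u n x‖ = 1 := by
    intro n x
    simp [u, Complex.norm_exp]
  have huc : ∀ n, Continuous (u n) := by
    intro n
    simp only [u]
    fun_prop
  have huu : ∀ n m x, u m x * (starRingEnd ℂ) (u n x) =
      Complex.exp (Complex.I * ((n : ℂ) - (m : ℂ)) * (x : ℂ)) := by
    intro n m x
    simp only [u, ← Complex.exp_conj, ← Complex.exp_add]
    congr 1
    simp
    ring
  have : IsFiniteMeasure μ := by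
    refine ⟨?_⟩
    simp [μ, ENNReal.mul_lt_top_iff]
  have hint : ∀ (n m : ℕ) (Y : Set ℝ), Y ⊆ Ico 0 (2 * Real.pi) →
      ∫ x in Y, u m x * (starRingEnd ℂ) (u n x) ∂μ = 1 / (2 * (Real.pi : ℂ)) *
        ∫ x in Y, Complex.exp (Complex.I * ((n : ℂ) - (m : ℂ)) * (x : ℂ)) := by
    intro n m Y hY
    have : μ.restrict Y = (ENNReal.ofReal (1 / (2 * Real.pi))) • volume.restrict Y := by
      rw [Measure.restrict_smul, Measure.restrict_restrict_of_subset hY]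
    rw [this, integral_smul_measure]
    simp_rw [huu]
    rw [ENNReal.toReal_ofReal (by positivity)]
    simp
  let f : ℕ → ℝ × ℝ → ℂ := fun n z => u n z.1 * (g n z.2 : ℂ)
  have hff : ∀ n m z, f m z * (starRingEnd ℂ) (f n z) =
      (u m z.1 * (starRingEnd ℂ) (u n z.1)) * ((g n z.2 * g m z.2 : ℝ) : ℂ) := by
    intro n m z
    simp [f]
    ring
  have hf : ∀ n, MemLp (f n) 2 (μ.prod ν) := by
    intro n
    have h1 : AEStronglyMeasurable (f n) (μ.prod ν) :=
      ((huc n).aestronglyMeasurable.comp_fst).mul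
        ((Complex.continuous_ofReal.comp_aestronglyMeasurable
          (hg n).aestronglyMeasurable).comp_snd)
    rw [memLp_two_iff_integrable_sq_norm h1]
    have h2 : ∀ z : ℝ × ℝ, ‖f n z‖ ^ 2 = (fun _ : ℝ => (1 : ℝ)) z.1 * (g n z.2) ^ 2 := by
      intro z
      simp [f, hu1]
    simp_rw [h2]
    exact (integrable_const (1 : ℝ)).mul_prod ((memLp_two_iff_integrable_sq
      (hg n).aestronglyMeasurable).1 (hg n))
  have hS : ∀ (n m : ℕ) (Y : Set ℝ), Y ⊆ Ico 0 (2 * Real.pi) →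
      ∫ z in Y ×ˢ univ, f m z * (starRingEnd ℂ) (f n z) ∂(μ.prod ν) =
      ((∫ r, g n r * g m r ∂ν : ℝ) : ℂ) * (1 / (2 * (Real.pi : ℂ)) *
        ∫ x in Y, Complex.exp (Complex.I * ((n : ℂ) - (m : ℂ)) * (x : ℂ))) := by
    intro n m Y hY
    simp_rw [hff]
    rw [← Measure.prod_restrict, Measure.restrict_univ, integral_prod_mul
      (fun x => u m x * (starRingEnd ℂ) (u n x)) (fun r => ((g n r * g m r : ℝ) : ℂ)),
      hint n m Y hY, integral_complex_ofReal, mul_comm]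
  have ho : ∀ n m, ∫ z, f m z * (starRingEnd ℂ) (f n z) ∂(μ.prod ν) = if n = m then 1 else 0 := by
    intro n m
    have h1 : μ.restrict (Ico 0 (2 * Real.pi)) = μ := by
      simp [μ, Measure.restrict_smul]
    have h2 := hS n m _ Subset.rfl
    rw [← Measure.prod_restrict, Measure.restrict_univ, h1] at h2
    rw [h2]
    split_ifs with hnm
    · subst hnm
      rw [hg1 n]
      have hpi : (Real.pi : ℂ) ≠ 0 := by exact_mod_cast Real.pi_ne_zero
      simp [Real.pi_pos.le]
      field_simp
    · have hc : Complex.I * ((n : ℂ) - (m : ℂ)) ≠ 0 :=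
        mul_ne_zero Complex.I_ne_zero (sub_ne_zero.2 (by exact_mod_cast hnm))
      have h3 : Complex.exp (Complex.I * ((n : ℂ) - (m : ℂ)) * ((2 * Real.pi : ℝ) : ℂ)) = 1 := by
        rw [Complex.exp_eq_one_iff]
        refine ⟨(n : ℤ) - m, ?_⟩
        push_cast
        ring
      rw [integral_Ico_eq_integral_Ioc, ← intervalIntegral.integral_of_le (by positivity),
        integral_exp_mul_complex hc, h3]
      simp
  obtain ⟨A, hA⟩ := exists_of_orthonormal b (μ.prod ν) f hf ho (X ×ˢ univ)
  exact ⟨A, fun n m => by rw [hA n m, hS n m X hX]⟩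

theorem exists_canonicalPhase {H : Type*} [NormedAddCommGroup H] [InnerProductSpace ℂ H]
    [CompleteSpace H] (b : HilbertBasis ℕ ℂ H) {X : Set ℝ} (hX : X ⊆ Ico 0 (2 * Real.pi)) :
    ∃ A : H →L[ℂ] H, IsPhaseEffect b (fun _ _ => 1) X A := by
  simpa using exists_isPhaseEffect_of_gram b (Measure.dirac 0) (fun _ _ => 1)
    (fun _ => memLp_const 1) (by simp) hX

theorem exists_groundStatePhase {H : Type*} [NormedAddCommGroup H] [InnerProductSpace ℂ H]
    [CompleteSpace H] (b : HilbertBasis ℕ ℂ H) {X : Set ℝ} (hX : X ⊆ Ico 0 (2 * Real.pi)) :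
    ∃ A : H →L[ℂ] H, IsPhaseEffect b groundStateMatrix X A := by
  let g : ℕ → ℝ → ℝ := fun n r =>
    Real.sqrt 2 * r ^ ((n : ℝ) + 1 / 2) * Real.exp (-r ^ 2 / 2) / Real.sqrt (n.factorial : ℝ)
  have hgg : ∀ (n m : ℕ) (r : ℝ), r ∈ Ioi (0 : ℝ) → g n r * g m r =
      2 / (Real.sqrt (n.factorial : ℝ) * Real.sqrt (m.factorial : ℝ)) *
        (r ^ ((n : ℝ) + m + 1) * Real.exp (-r ^ (2 : ℝ))) := by
    intro n m r hr
    have h1 : r ^ ((n : ℝ) + m + 1) = r ^ ((n : ℝ) + 1 / 2) * r ^ ((m : ℝ) + 1 / 2) := by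
      rw [← Real.rpow_add hr]
      ring_nf
    have h2 : Real.exp (-r ^ (2 : ℝ)) = Real.exp (-r ^ 2 / 2) * Real.exp (-r ^ 2 / 2) := by
      rw [← Real.exp_add, Real.rpow_two]
      ring_nf
    have h3 : (2 : ℝ) = Real.sqrt 2 * Real.sqrt 2 := by simp
    rw [h1, h2]
    simp only [g]
    calc _ = (Real.sqrt 2 * Real.sqrt 2) / (Real.sqrt (n.factorial : ℝ) *
          Real.sqrt (m.factorial : ℝ)) * (r ^ ((n : ℝ) + 1 / 2) * r ^ ((m : ℝ) + 1 / 2) *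
            (Real.exp (-r ^ 2 / 2) * Real.exp (-r ^ 2 / 2))) := by ring
      _ = _ := by rw [← h3]
  have hint : ∀ n m : ℕ, ∫ r in Ioi (0 : ℝ), g n r * g m r =
      Real.Gamma (((n : ℝ) + (m : ℝ)) / 2 + 1) /
        (Real.sqrt (n.factorial : ℝ) * Real.sqrt (m.factorial : ℝ)) := by
    intro n m
    rw [setIntegral_congr_fun measurableSet_Ioi (hgg n m), integral_const_mul,
      integral_rpow_mul_exp_neg_rpow (by norm_num) (by
        have h1 : (0 : ℝ) ≤ n := n.cast_nonneg
        have h2 : (0 : ℝ) ≤ m := m.cast_nonneg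
        linarith)]
    have : ((n : ℝ) + m + 1 + 1) / 2 = ((n : ℝ) + (m : ℝ)) / 2 + 1 := by ring
    rw [this]
    ring
  have hmeas : ∀ n, Measurable (g n) := by
    intro n
    simp only [g]
    fun_prop
  have h := exists_isPhaseEffect_of_gram b (volume.restrict (Ioi 0)) g ?_ ?_ hX
  · simp_rw [hint] at h
    exact h
  · intro n
    rw [memLp_two_iff_integrable_sq (hmeas n).aestronglyMeasurable]
    have : IntegrableOn (fun r => g n r * g n r) (Ioi 0) := by
      rw [integrableOn_congr_fun (hgg n n) measurableSet_Ioi]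
      refine Integrable.const_mul (integrableOn_rpow_mul_exp_neg_rpow ?_ (by norm_num)) _
      have : (0 : ℝ) ≤ n := n.cast_nonneg
      linarith
    simpa only [sq] using this.integrable
  · intro n
    rw [hint]
    have : ((n : ℝ) + (n : ℝ)) / 2 + 1 = n + 1 := by ring
    rw [this, Real.Gamma_nat_eq_factorial, Real.mul_self_sqrt (by positivity)]
    exact div_self (by positivity)

/-- The effects of the canonical phase do have the defining matrix elements. -/
theorem canonicalPhase_spec {H : Type*} [NormedAddCommGroup H] [InnerProductSpace ℂ H]
    [CompleteSpace H] (b : HilbertBasis ℕ ℂ H) {X : Set ℝ} (hX : X ⊆ Ico 0 (2 * Real.pi)) :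
    IsPhaseEffect b (fun _ _ => 1) X (canonicalPhase b X) :=
  isPhaseEffect_phaseEffect (exists_canonicalPhase b hX)

/-- The effects of the ground state phase do have the defining matrix elements. -/
theorem groundStatePhase_spec {H : Type*} [NormedAddCommGroup H] [InnerProductSpace ℂ H]
    [CompleteSpace H] (b : HilbertBasis ℕ ℂ H) {X : Set ℝ} (hX : X ⊆ Ico 0 (2 * Real.pi)) :
    IsPhaseEffect b groundStateMatrix X (groundStatePhase b X) :=
  isPhaseEffect_phaseEffect (exists_groundStatePhase b hX)

end NumberPhase

open Filter Topology
open scoped ComplexOrder ComplexConjugate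

/-! Upper bound: both phase matrices are positive semidefinite with unit diagonal. Hence `E(X)` is
positive, and so is `1 - E(X)`, which is the effect of the complement of `X`; therefore `‖E(X)‖ ≤ 1`
(`IsPhaseEffect.norm_le_one`).

Lower bound (`IsPhaseEffect.one_le_norm`): the only input on the phase matrix is that it tends to
`1` along diagonals. Move the coefficients of a trigonometric polynomial `f` to basis vectors of
ever higher index. The norm of the vector stays `‖f‖`, while the quadratic form of `E(X)` tends to
the integral of `|f|²` over `X`. Shifting also makes room for negative frequencies, so all
trigonometric polynomials occur, and by density `‖1_X f‖² ≤ ‖E(X)‖ ‖f‖²` on all of `L²`. Taking `f =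
1_X`, which is nonzero because `X` has positive measure, gives `1 ≤ ‖E(X)‖`.

For the ground state the diagonal limit comes from `Γ(s + k + 1) ~ k ^ s * k!`
(`tendsto_groundStateMatrix`). -/

/-! ### Positivity of bounded operators on a total family. -/

/-- Sesquilinear expansion of the inner product of two combinations with equal coefficients. -/
theorem inner_sum_smul_sum_smul {ι E : Type*} [NormedAddCommGroup E] [InnerProductSpace ℂ E]
    (s : Finset ι) (a : ι → ℂ) (u w : ι → E) :
    inner ℂ (∑ i ∈ s, a i • u i) (∑ i ∈ s, a i • w i) =
      ∑ i ∈ s, ∑ j ∈ s, conj (a i) * a j * inner ℂ (u i) (w j) := by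
  simp_rw [sum_inner, inner_sum, inner_smul_left, inner_smul_right, mul_assoc]

/-- Positivity of a bounded operator can be tested on the span of a total family. -/
theorem ContinuousLinearMap.isPositive_of_span {ι E : Type*} [NormedAddCommGroup E]
    [InnerProductSpace ℂ E] [CompleteSpace E] {u : ι → E}
    (hu : Dense (Submodule.span ℂ (range u) : Set E)) (T : E →L[ℂ] E)
    (h : ∀ (s : Finset ι) (a : ι → ℂ),
      0 ≤ ∑ i ∈ s, ∑ j ∈ s, conj (a i) * a j * inner ℂ (u i) (T (u j))) : T.IsPositive := by
  have key : ∀ x, 0 ≤ inner ℂ x (T x) := by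
    intro x
    have hc : IsClosed {x : E | 0 ≤ inner ℂ x (T x)} :=
      isClosed_le continuous_const (by fun_prop)
    refine hc.closure_subset_iff.2 ?_ (hu x)
    intro y hy
    obtain ⟨a, rfl⟩ := Finsupp.mem_span_range_iff_exists_finsupp.1 hy
    simp only [mem_ofPred_eq, Finsupp.sum, map_sum, map_smul]
    rw [inner_sum_smul_sum_smul]
    exact h a.support a
  -- The complex order makes `key` also say that the form is real; conjugation passes to the
  -- convention `inner (T x) x`.
  rw [ContinuousLinearMap.isPositive_iff_complex]
  intro x
  have h1 := key x
  rw [← inner_conj_symm, Complex.nonneg_iff] at h1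
  simp only [Complex.conj_re, Complex.conj_im] at h1
  refine ⟨?_, h1.1⟩
  apply Complex.ext <;> simp
  linarith [h1.2]

/-! ### Upper bound: positive semidefinite phase matrices. -/

namespace NumberPhase

variable {H : Type*} [NormedAddCommGroup H] [InnerProductSpace ℂ H]

/-- Finite sections of the phase matrix are positive semidefinite. -/
def IsPosSemidefKernel (c : ℕ → ℕ → ℂ) : Prop :=
  ∀ (s : Finset ℕ) (a : ℕ → ℂ), 0 ≤ ∑ n ∈ s, ∑ m ∈ s, conj (a n) * a m * c n m

theorem integrableOn_phase (k : ℂ) {X : Set ℝ} (hX : X ⊆ Ico 0 (2 * Real.pi)) :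
    IntegrableOn (fun x : ℝ => Complex.exp (Complex.I * k * (x : ℂ))) X := by
  refine IntegrableOn.mono_set ?_ (hX.trans Ico_subset_Icc_self)
  exact Continuous.integrableOn_Icc (by fun_prop)

/-- The quadratic form of `A` is an average over `x ∈ X` of the form of `c`, evaluated at the
rotated coefficients `a n * exp (-i n x)`; the integrand is nonnegative pointwise. -/
theorem IsPhaseEffect.isPositive [CompleteSpace H] {b : HilbertBasis ℕ ℂ H} {c : ℕ → ℕ → ℂ}
    {X : Set ℝ} {A : H →L[ℂ] H} (hA : IsPhaseEffect b c X A) (hc : IsPosSemidefKernel c)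
    (hX : X ⊆ Ico 0 (2 * Real.pi)) : A.IsPositive := by
  refine A.isPositive_of_span
    ((Submodule.dense_iff_topologicalClosure_eq_top).2 b.dense_span) fun s a => ?_
  have h1 : ∑ n ∈ s, ∑ m ∈ s, conj (a n) * a m * inner ℂ (b n) (A (b m)) =
      1 / (2 * (Real.pi : ℂ)) * ∫ x in X, ∑ n ∈ s, ∑ m ∈ s, conj (a n) * a m * c n m *
        Complex.exp (Complex.I * ((n : ℂ) - (m : ℂ)) * (x : ℂ)) := by
    rw [integral_finsetSum _ fun n _ => integrable_finsetSum _ fun m _ =>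
      (integrableOn_phase _ hX).const_mul _, Finset.mul_sum]
    refine Finset.sum_congr rfl fun n _ => ?_
    rw [integral_finsetSum _ fun m _ => (integrableOn_phase _ hX).const_mul _, Finset.mul_sum]
    refine Finset.sum_congr rfl fun m _ => ?_
    rw [integral_const_mul, hA n m]
    ring
  rw [h1]
  refine mul_nonneg ?_ (integral_nonneg fun x => ?_)
  · have : (0 : ℝ) ≤ 1 / (2 * Real.pi) := by positivity
    exact_mod_cast this
  · refine (hc s fun n => a n * Complex.exp (-(Complex.I * n * x))).trans_eq
      (Finset.sum_congr rfl fun n _ => Finset.sum_congr rfl fun m _ => ?_)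
    rw [map_mul, ← Complex.exp_conj]
    have : Complex.exp (Complex.I * ((n : ℂ) - (m : ℂ)) * (x : ℂ)) =
        Complex.exp (conj (-(Complex.I * n * x))) * Complex.exp (-(Complex.I * m * x)) := by
      rw [← Complex.exp_add]
      congr 1
      simp
      ring
    rw [this]
    ring

theorem integral_phase_Ico (n m : ℕ) :
    1 / (2 * (Real.pi : ℂ)) * ∫ x in Ico 0 (2 * Real.pi),
      Complex.exp (Complex.I * ((n : ℂ) - (m : ℂ)) * (x : ℂ)) = if n = m then 1 else 0 := by
  split_ifs with hnm
  · subst hnm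
    have hpi : (Real.pi : ℂ) ≠ 0 := by exact_mod_cast Real.pi_ne_zero
    simp [Real.pi_pos.le]
    field_simp
  · have hc : Complex.I * ((n : ℂ) - (m : ℂ)) ≠ 0 :=
      mul_ne_zero Complex.I_ne_zero (sub_ne_zero.2 (by exact_mod_cast hnm))
    have h3 : Complex.exp (Complex.I * ((n : ℂ) - (m : ℂ)) * ((2 * Real.pi : ℝ) : ℂ)) = 1 := by
      rw [Complex.exp_eq_one_iff]
      refine ⟨(n : ℤ) - m, ?_⟩
      push_cast
      ring
    rw [integral_Ico_eq_integral_Ioc, ← intervalIntegral.integral_of_le (by positivity),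
      integral_exp_mul_complex hc, h3]
    simp

/-- The effect of the complement. -/
theorem IsPhaseEffect.one_sub {b : HilbertBasis ℕ ℂ H} {c : ℕ → ℕ → ℂ} {X : Set ℝ}
    {A : H →L[ℂ] H} (hA : IsPhaseEffect b c X A) (hc : ∀ n, c n n = 1) (hXm : MeasurableSet X)
    (hX : X ⊆ Ico 0 (2 * Real.pi)) : IsPhaseEffect b c (Ico 0 (2 * Real.pi) \ X) (1 - A) := by
  intro n m
  rw [setIntegral_sdiff hXm (integrableOn_phase _ Subset.rfl) hX, mul_sub, mul_sub, ← hA n m,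
    integral_phase_Ico, sub_apply, inner_sub_right, one_apply_eq_self,
    orthonormal_iff_ite.1 b.orthonormal]
  split_ifs with h
  · subst h
    simp [hc]
  · simp

theorem IsPhaseEffect.norm_le_one [CompleteSpace H] {b : HilbertBasis ℕ ℂ H} {c : ℕ → ℕ → ℂ}
    {X : Set ℝ} {A : H →L[ℂ] H} (hA : IsPhaseEffect b c X A) (hc : IsPosSemidefKernel c)
    (hc1 : ∀ n, c n n = 1) (hXm : MeasurableSet X) (hX : X ⊆ Ico 0 (2 * Real.pi)) :
    ‖A‖ ≤ 1 := by
  rw [CStarAlgebra.norm_le_one_iff_of_nonneg A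
    ((ContinuousLinearMap.nonneg_iff_isPositive A).2 (hA.isPositive hc hX)),
    ContinuousLinearMap.le_def]
  exact (hA.one_sub hc1 hXm hX).isPositive hc sdiff_subset

theorem isPosSemidefKernel_one : IsPosSemidefKernel fun _ _ => 1 := by
  intro s a
  have : ∑ n ∈ s, ∑ m ∈ s, conj (a n) * a m * 1 = star (∑ n ∈ s, a n) * ∑ n ∈ s, a n := by
    simp [Finset.sum_mul_sum]
  rw [this]
  exact star_mul_self_nonneg _

/-- Euler's integral exhibits the matrix as the Gram matrix of the functions `t ^ (n / 2) / √n!` for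
the weight `exp (-t)` on the half-line. -/
theorem isPosSemidefKernel_groundStateMatrix : IsPosSemidefKernel groundStateMatrix := by
  intro s a
  let g : ℕ → ℝ → ℝ := fun n t => t ^ ((n : ℝ) / 2) / √(n.factorial : ℝ)
  have hg : ∀ (n m : ℕ) (t : ℝ), t ∈ Ioi (0 : ℝ) → Real.exp (-t) * (g n t * g m t) =
      1 / (√(n.factorial : ℝ) * √(m.factorial : ℝ)) *
        (Real.exp (-t) * t ^ (((n : ℝ) + m) / 2 + 1 - 1)) := by
    intro n m t ht
    have h1 : t ^ (((n : ℝ) + m) / 2 + 1 - 1) = t ^ ((n : ℝ) / 2) * t ^ ((m : ℝ) / 2) := by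
      rw [← Real.rpow_add ht]
      ring_nf
    rw [h1]
    simp only [g]
    ring
  have hi : ∀ n m : ℕ, IntegrableOn (fun t => Real.exp (-t) * (g n t * g m t)) (Ioi 0) := by
    intro n m
    rw [integrableOn_congr_fun (hg n m) measurableSet_Ioi]
    exact (Real.GammaIntegral_convergent (by positivity)).const_mul _
  have hG : ∀ n m : ℕ, groundStateMatrix n m =
      ∫ t in Ioi (0 : ℝ), ((Real.exp (-t) * (g n t * g m t) : ℝ) : ℂ) := by
    intro n m
    rw [integral_complex_ofReal, setIntegral_congr_fun measurableSet_Ioi (hg n m),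
      integral_const_mul, ← Real.Gamma_eq_integral (by positivity), groundStateMatrix]
    congr 1
    ring
  have hi' : ∀ n m : ℕ, IntegrableOn
      (fun t => conj (a n) * a m * ((Real.exp (-t) * (g n t * g m t) : ℝ) : ℂ)) (Ioi 0) :=
    fun n m => (hi n m).ofReal.const_mul _
  have h1 : ∑ n ∈ s, ∑ m ∈ s, conj (a n) * a m * groundStateMatrix n m =
      ∫ t in Ioi (0 : ℝ), ∑ n ∈ s, ∑ m ∈ s,
        conj (a n) * a m * ((Real.exp (-t) * (g n t * g m t) : ℝ) : ℂ) := by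
    rw [integral_finsetSum _ fun n _ => integrable_finsetSum _ fun m _ => hi' n m]
    refine Finset.sum_congr rfl fun n _ => ?_
    rw [integral_finsetSum _ fun m _ => hi' n m]
    refine Finset.sum_congr rfl fun m _ => ?_
    rw [integral_const_mul, hG n m]
  rw [h1]
  refine integral_nonneg fun t => ?_
  have h2 : ∑ n ∈ s, ∑ m ∈ s, conj (a n) * a m * ((Real.exp (-t) * (g n t * g m t) : ℝ) : ℂ) =
      (Real.exp (-t) : ℂ) * (star (∑ n ∈ s, a n * g n t) * ∑ n ∈ s, a n * g n t) := by
    rw [star_sum, Finset.sum_mul_sum, Finset.mul_sum]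
    refine Finset.sum_congr rfl fun n _ => ?_
    rw [Finset.mul_sum]
    refine Finset.sum_congr rfl fun m _ => ?_
    simp
    ring
  simp only [Pi.zero_apply, h2]
  refine mul_nonneg ?_ (star_mul_self_nonneg _)
  exact_mod_cast (Real.exp_pos _).le

theorem groundStateMatrix_self (n : ℕ) : groundStateMatrix n n = 1 := by
  have : ((n : ℝ) + (n : ℝ)) / 2 + 1 = n + 1 := by ring
  rw [groundStateMatrix, this, Real.Gamma_nat_eq_factorial, Real.mul_self_sqrt (by positivity),
    div_self (by positivity), Complex.ofReal_one]

end NumberPhase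

/-! ### Gamma asymptotics and transfer to the circle. -/

theorem Complex.ofReal_norm_sq_eq_inner {E : Type*} [NormedAddCommGroup E]
    [InnerProductSpace ℂ E] (x : E) : ((‖x‖ ^ 2 : ℝ) : ℂ) = inner ℂ x x := by
  simp [inner_self_eq_norm_sq_to_K]

theorem Real.Gamma_add_natCast {s : ℝ} (hs : 0 < s) (k : ℕ) :
    Real.Gamma (s + k) = (∏ j ∈ Finset.range k, (s + j)) * Real.Gamma s := by
  induction k with
  | zero => simp
  | succ k ih =>
    rw [Finset.prod_range_succ, Nat.cast_succ, ← add_assoc, Real.Gamma_add_one (by positivity), ih]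
    ring

/-- `Γ (s + k + 1)` is asymptotically equal to `k ^ s * k!`. -/
theorem Real.tendsto_Gamma_add_natCast_div {s : ℝ} (hs : 0 < s) :
    Tendsto (fun k : ℕ => Real.Gamma (s + k + 1) / ((k : ℝ) ^ s * (k.factorial : ℝ)))
      atTop (𝓝 1) := by
  have hG := (Real.Gamma_pos_of_pos hs).ne'
  -- By the functional equation, the quotient is exactly `Γ(s)` divided by Euler's approximant
  -- `GammaSeq s k`.
  have h := (tendsto_const_nhds (x := Real.Gamma s)).div (Real.GammaSeq_tendsto_Gamma s) hG
  rw [div_self hG] at h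
  refine h.congr fun k => ?_
  have := Real.Gamma_add_natCast hs (k + 1)
  rw [Nat.cast_succ, ← add_assoc] at this
  rw [this, Pi.div_apply, Real.GammaSeq]
  field_simp

/-- `Lp` restriction of the Fourier monomials, paired over a set. -/
theorem inner_LpToLpRestrictCLM_fourierLp {T : ℝ} [Fact (0 < T)] (Y : Set (AddCircle T))
    (k l : ℤ) :
    inner ℂ (LpToLpRestrictCLM (AddCircle T) ℂ ℂ AddCircle.haarAddCircle 2 Y (fourierLp 2 k))
      (LpToLpRestrictCLM (AddCircle T) ℂ ℂ AddCircle.haarAddCircle 2 Y (fourierLp 2 l)) =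
      ∫ t in Y, fourier (l - k) t ∂AddCircle.haarAddCircle := by
  rw [L2.inner_def]
  refine integral_congr_ae ?_
  have h : ∀ k : ℤ, LpToLpRestrictCLM (AddCircle T) ℂ ℂ AddCircle.haarAddCircle 2 Y
      (fourierLp 2 k) =ᵐ[AddCircle.haarAddCircle.restrict Y] fourier k := fun k =>
    (LpToLpRestrictCLM_coeFn ℂ Y _).trans (ae_restrict_of_ae (coeFn_fourierLp 2 k))
  filter_upwards [h k, h l] with t h1 h2
  rw [h1, h2, RCLike.inner_apply, sub_eq_add_neg, fourier_add, fourier_neg]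

/-- A measurable subset of a fundamental interval, seen in the circle. -/
theorem AddCircle.exists_setIntegral_haar_eq {T : ℝ} [hT : Fact (0 < T)] {X : Set ℝ}
    (hX : MeasurableSet X) (hXT : X ⊆ Ico 0 T) :
    ∃ Y : Set (AddCircle T), MeasurableSet Y ∧ ∀ g : C(AddCircle T, ℂ),
      ∫ t in Y, g t ∂AddCircle.haarAddCircle = 1 / (T : ℂ) * ∫ x in X, g (x : AddCircle T) := by
  let Y : Set (AddCircle T) :=
    (fun t => (AddCircle.measurableEquivIco T 0 t : ℝ)) ⁻¹' X
  have hY : MeasurableSet Y :=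
    (measurable_subtype_coe.comp (AddCircle.measurableEquivIco T 0).measurable) hX
  refine ⟨Y, hY, fun g => ?_⟩
  have hmk := AddCircle.measurePreserving_mk T 0
  have hXY : ((volume.restrict (Ioc 0 (0 + T))).restrict
      ((fun x : ℝ => (x : AddCircle T)) ⁻¹' Y)) = volume.restrict X := by
    rw [Measure.restrict_restrict (AddCircle.measurable_mk' hY)]
    refine Measure.restrict_congr_set (eventuallyEq_set.2 ?_)
    -- The quotient map is measure preserving on `Ioc`, whereas `X` lies in `Ico`; discarding both
    -- endpoints reconciles them.
    have h0 : ∀ᵐ x : ℝ, x ≠ 0 := by simp [ae_iff]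
    have hT0 : ∀ᵐ x : ℝ, x ≠ T := by simp [ae_iff]
    filter_upwards [h0, hT0] with x hx0 hxT
    have hmem : x ∈ Ico 0 (0 + T) → ((AddCircle.measurableEquivIco T 0 (x : AddCircle T) : ℝ)) = x :=
      fun hx => AddCircle.equivIco_coe_of_mem hx
    simp only [Y, mem_inter_iff, mem_preimage]
    constructor
    · rintro ⟨hx, h1, h2⟩
      rwa [hmem ⟨h1.le, h2.lt_of_ne (by simpa using hxT)⟩] at hx
    · intro hx
      obtain ⟨h1, h2⟩ := hXT hx
      have h3 : x ∈ Ico 0 (0 + T) := ⟨h1, by simpa using h2⟩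
      exact ⟨by rwa [hmem h3], h1.lt_of_ne hx0.symm, h3.2.le⟩
  have h1 : ∫ t in Y, g t = ∫ x in X, g (x : AddCircle T) := by
    rw [← hXY, ← setIntegral_map hY g.continuous.aestronglyMeasurable hmk.measurable.aemeasurable,
      hmk.map_eq]
  rw [← h1, AddCircle.volume_eq_smul_haarAddCircle, Measure.restrict_smul, integral_smul_measure,
    ENNReal.toReal_ofReal hT.out.le]
  have : (T : ℂ) ≠ 0 := by exact_mod_cast hT.out.ne'
  rw [Complex.real_smul]
  field_simp

/-! ### Lower bound: shifted trigonometric polynomials. -/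

namespace NumberPhase

variable {H : Type*} [NormedAddCommGroup H] [InnerProductSpace ℂ H]

/-- Write each Gamma value and factorial as a ratio tending to `1` times `k ^ s * k!`; these leading
factors cancel exactly. -/
theorem tendsto_groundStateMatrix (n m : ℕ) :
    Tendsto (fun k => groundStateMatrix (n + k) (m + k)) atTop (𝓝 1) := by
  -- The extra `1` keeps every exponent `s` positive, including when `n` or `m` is `0`.
  rw [← tendsto_add_atTop_iff_nat 1]
  let r : ℝ → ℕ → ℝ := fun s k => Real.Gamma (s + k + 1) / ((k : ℝ) ^ s * (k.factorial : ℝ))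
  have hr : ∀ s, 0 < s → Tendsto (r s) atTop (𝓝 1) :=
    fun s hs => Real.tendsto_Gamma_add_natCast_div hs
  have h : Tendsto (fun k => r (((n : ℝ) + m) / 2 + 1) k / (√(r (n + 1) k) * √(r (m + 1) k)))
      atTop (𝓝 1) := by
    have := (hr (((n : ℝ) + m) / 2 + 1) (by positivity)).div
      ((hr (n + 1) (by positivity)).sqrt.mul (hr (m + 1) (by positivity)).sqrt) (by simp)
    simpa [Pi.div_def] using this
  have h' := (Complex.continuous_ofReal.tendsto 1).comp h
  rw [Complex.ofReal_one] at h'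
  refine h'.congr' ?_
  filter_upwards [eventually_gt_atTop 0] with k hk
  have hk : (0 : ℝ) < k := by exact_mod_cast hk
  have hf : (0 : ℝ) < k.factorial := by exact_mod_cast k.factorial_pos
  have hfac : ∀ n : ℕ, √((n + (k + 1)).factorial : ℝ) =
      √(r (n + 1) k) * √((k : ℝ) ^ ((n : ℝ) + 1) * (k.factorial : ℝ)) := by
    intro n
    rw [← Real.sqrt_mul' _ (by positivity), ← Real.Gamma_nat_eq_factorial]
    simp only [r]
    rw [div_mul_cancel₀ _ (by positivity)]
    push_cast
    ring_nf
  have hpow : √((k : ℝ) ^ ((n : ℝ) + 1) * (k.factorial : ℝ)) *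
      √((k : ℝ) ^ ((m : ℝ) + 1) * (k.factorial : ℝ)) =
      (k : ℝ) ^ (((n : ℝ) + m) / 2 + 1) * (k.factorial : ℝ) := by
    rw [← Real.sqrt_mul (by positivity), Real.sqrt_eq_iff_mul_self_eq (by positivity)
      (by positivity)]
    have : (k : ℝ) ^ (((n : ℝ) + m) / 2 + 1) * (k : ℝ) ^ (((n : ℝ) + m) / 2 + 1) =
        (k : ℝ) ^ ((n : ℝ) + 1) * (k : ℝ) ^ ((m : ℝ) + 1) := by
      rw [← Real.rpow_add hk, ← Real.rpow_add hk]
      ring_nf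
    linear_combination -(k.factorial : ℝ) ^ 2 * this
  have hΓ : Real.Gamma ((((n + (k + 1) : ℕ) : ℝ) + ((m + (k + 1) : ℕ) : ℝ)) / 2 + 1) =
      r (((n : ℝ) + m) / 2 + 1) k *
        ((k : ℝ) ^ (((n : ℝ) + m) / 2 + 1) * (k.factorial : ℝ)) := by
    simp only [r]
    rw [div_mul_cancel₀ _ (by positivity)]
    push_cast
    ring_nf
  simp only [Function.comp_apply, groundStateMatrix]
  rw [hΓ, hfac, hfac, mul_mul_mul_comm, hpow, mul_div_mul_right _ _ (by positivity)]

/-- If the phase matrix tends to `1` along the diagonals, the translates of a trigonometric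
polynomial bound the norm of the effect from below. -/
theorem IsPhaseEffect.one_le_norm {b : HilbertBasis ℕ ℂ H} {c : ℕ → ℕ → ℂ} {X : Set ℝ}
    {A : H →L[ℂ] H} (hA : IsPhaseEffect b c X A)
    (hc : ∀ n m, Tendsto (fun k => c (n + k) (m + k)) atTop (𝓝 1)) (hXm : MeasurableSet X)
    (hX : X ⊆ Ico 0 (2 * Real.pi)) (hpos : 0 < volume X) : 1 ≤ ‖A‖ := by
  have : Fact (0 < 2 * Real.pi) := ⟨by positivity⟩
  obtain ⟨Y, hY, hYX⟩ := AddCircle.exists_setIntegral_haar_eq hXm hX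
  let R := LpToLpRestrictCLM (AddCircle (2 * Real.pi)) ℂ ℂ AddCircle.haarAddCircle 2 Y
  have key : ∀ f, ‖R f‖ ^ 2 ≤ ‖A‖ * ‖f‖ ^ 2 := by
    intro f
    have hcl : IsClosed {f | ‖R f‖ ^ 2 ≤ ‖A‖ * ‖f‖ ^ 2} :=
      isClosed_le (by fun_prop) (by fun_prop)
    have hd := (Submodule.dense_iff_topologicalClosure_eq_top).2
      (span_fourierLp_closure_eq_top (T := 2 * Real.pi) (p := 2) (by simp))
    refine hcl.closure_subset_iff.2 ?_ (hd f)
    intro y hy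
    obtain ⟨a, rfl⟩ := Finsupp.mem_span_range_iff_exists_finsupp.1 hy
    simp only [Finsupp.sum, mem_ofPred_eq, map_sum, map_smul]
    obtain ⟨D, hD⟩ := a.support.exists_le
    -- Frequencies are reversed because the entry `(n, m)` carries `exp (i (n - m) x)`, while the
    -- pairing of modes `k` and `l` carries frequency `l - k`. The bound `D` makes all indices
    -- natural.
    let p : ℤ → ℕ := fun k => (D - k).toNat
    have hp : ∀ k ∈ a.support, (p k : ℤ) = D - k :=
      fun k hk => Int.toNat_of_nonneg (sub_nonneg.2 (hD k hk))
    let v : ℕ → H := fun K => ∑ k ∈ a.support, a k • b (p k + K)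
    have hv : ∀ K, ‖v K‖ = ‖∑ k ∈ a.support, a k • fourierLp (T := 2 * Real.pi) 2 k‖ := by
      intro K
      rw [← sq_eq_sq₀ (norm_nonneg _) (norm_nonneg _)]
      apply Complex.ofReal_injective
      rw [Complex.ofReal_norm_sq_eq_inner, Complex.ofReal_norm_sq_eq_inner, inner_sum_smul_sum_smul,
        inner_sum_smul_sum_smul]
      refine Finset.sum_congr rfl fun k hk => Finset.sum_congr rfl fun l hl => ?_
      rw [orthonormal_iff_ite.1 b.orthonormal, orthonormal_iff_ite.1 orthonormal_fourier]
      have : p k + K = p l + K ↔ k = l := by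
        have := hp k hk
        have := hp l hl
        lia
      simp only [this]
    have hlim : Tendsto (fun K => inner ℂ (v K) (A (v K))) atTop
        (𝓝 (((‖∑ k ∈ a.support, a k • R (fourierLp 2 k)‖ ^ 2 : ℝ) : ℂ))) := by
      rw [Complex.ofReal_norm_sq_eq_inner, inner_sum_smul_sum_smul]
      simp only [v, map_sum, map_smul, inner_sum_smul_sum_smul]
      refine tendsto_finsetSum _ fun k hk => tendsto_finsetSum _ fun l hl =>
        Tendsto.const_mul _ ?_
      -- The integral depends only on the index difference, so the shift `K` affects nothing but
      -- `c`.
      have h1 : ∀ K, inner ℂ (b (p k + K)) (A (b (p l + K))) = c (p k + K) (p l + K) *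
          inner ℂ (R (fourierLp 2 k)) (R (fourierLp 2 l)) := by
        intro K
        rw [hA, inner_LpToLpRestrictCLM_fourierLp, hYX]
        have hkl : ((p k + K : ℕ) : ℂ) - ((p l + K : ℕ) : ℂ) = ((l - k : ℤ) : ℂ) := by
          have : ((p k + K : ℕ) : ℤ) - ((p l + K : ℕ) : ℤ) = l - k := by
            have := hp k hk
            have := hp l hl
            lia
          exact_mod_cast congrArg (Int.cast : ℤ → ℂ) this
        rw [hkl]
        congr 2
        · push_cast
          rfl
        · refine integral_congr_ae (Eventually.of_forall fun x => ?_)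
          simp only [fourier_coe_apply]
          congr 1
          have hpi : (Real.pi : ℂ) ≠ 0 := by exact_mod_cast Real.pi_ne_zero
          push_cast
          field_simp
      simp only [h1]
      simpa using (hc (p k) (p l)).mul_const _
    have hle : ∀ K, ‖inner ℂ (v K) (A (v K))‖ ≤ ‖A‖ *
        ‖∑ k ∈ a.support, a k • fourierLp (T := 2 * Real.pi) 2 k‖ ^ 2 := by
      intro K
      rw [← hv K]
      calc _ ≤ ‖v K‖ * ‖A (v K)‖ := norm_inner_le_norm _ _
        _ ≤ ‖v K‖ * (‖A‖ * ‖v K‖) := by gcongr; exact A.le_opNorm _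
        _ = _ := by ring
    have := le_of_tendsto hlim.norm (Eventually.of_forall hle)
    rwa [Complex.norm_real, Real.norm_of_nonneg (by positivity)] at this
  have hYpos : 0 < AddCircle.haarAddCircle.real Y := by
    have h1 := hYX 1
    simp only [ContinuousMap.one_apply, integral_const, MeasurableSet.univ, measureReal_restrict_apply,
      univ_inter, Complex.real_smul, mul_one] at h1
    have h2 : AddCircle.haarAddCircle.real Y = 1 / (2 * Real.pi) * volume.real X := by
      exact_mod_cast h1
    rw [h2]
    have : volume X ≠ ⊤ := ((measure_mono hX).trans_lt measure_Ico_lt_top).ne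
    have : 0 < volume.real X := ENNReal.toReal_pos hpos.ne' this
    positivity
  have hYt : AddCircle.haarAddCircle Y ≠ ⊤ := measure_ne_top _ _
  -- Restriction to `Y` preserves the norm of its indicator, so `key` reads `‖f‖² ≤ ‖A‖ ‖f‖²` with
  -- `f ≠ 0`.
  have h := key (indicatorConstLp 2 hY hYt 1)
  have hR : ‖R (indicatorConstLp 2 hY hYt 1)‖ = ‖indicatorConstLp 2 hY hYt (1 : ℂ)‖ := by
    rw [Lp.norm_def, Lp.norm_def]
    congr 1
    rw [eLpNorm_congr_ae (LpToLpRestrictCLM_coeFn ℂ Y _), ← eLpNorm_indicator_eq_eLpNorm_restrict hY]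
    refine eLpNorm_congr_ae ?_
    filter_upwards [indicatorConstLp_coeFn (p := 2) (hs := hY) (hμs := hYt) (c := (1 : ℂ))] with t ht
    by_cases hm : t ∈ Y <;> simp [hm, ht]
  rw [hR] at h
  have hn : 0 < ‖indicatorConstLp 2 hY hYt (1 : ℂ)‖ := by
    rw [norm_indicatorConstLp (by simp) (by simp)]
    simpa using Real.rpow_pos_of_pos hYpos _
  exact le_of_mul_le_mul_right (by simpa using h) (pow_pos hn 2)

end NumberPhase

theorem mainTheorem1 {H : Type*} [NormedAddCommGroup H] [InnerProductSpace ℂ H] [CompleteSpace H]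
    (b : HilbertBasis ℕ ℂ H) (X : Set ℝ) (hX : MeasurableSet X)
    (hXsub : X ⊆ Ico 0 (2 * Real.pi)) (hpos : 0 < volume X) :
    ‖NumberPhase.canonicalPhase b X‖ = 1 ∧ ‖NumberPhase.groundStatePhase b X‖ = 1 := by
  have h1 := NumberPhase.canonicalPhase_spec b hXsub
  have h2 := NumberPhase.groundStatePhase_spec b hXsub
  exact ⟨le_antisymm
      (h1.norm_le_one NumberPhase.isPosSemidefKernel_one (fun _ => rfl) hX hXsub)
      (h1.one_le_norm (fun _ _ => tendsto_const_nhds) hX hXsub hpos),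
    le_antisymm
      (h2.norm_le_one NumberPhase.isPosSemidefKernel_groundStateMatrix
        NumberPhase.groundStateMatrix_self hX hXsub)
      (h2.one_le_norm NumberPhase.tendsto_groundStateMatrix hX hXsub hpos)⟩
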